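/- Let $\Omega$ be a nonempty set, let $F(\Omega)$ be the set of all real functions on $\Omega$ and $B(\Omega)$ the set of bounded ones. Let $\ge_*$ be a reflexive, transitive relation on $F(\Omega)$ with asymmetric part $>_*$ such that: $1>_*0$; $f\ge g$ pointwise implies $f\ge_* g$; $f\ge_* g$ implies $bf+h\ge_* bg+h$ for all $b\in B(\Omega)$ with $b\ge 0$ and all $h\in F(\Omega)$; and $f>_*0$ implies $f\wedge 1>_*0$. Let $X\subset F(\Omega)$ be a convex set containing $0$ and $1$ such that every $f\in X$ satisfies $f\ge_* a$ for some $a\in\mathbb R$, and $f+\lambda\in X$ for all $f\in X$, $\lambda\ge0$. Put $$L(X)=\{g\in F(\Omega):\ \lambda x\ge_*|g|\text{ for some }\lambda>0,\ x\in X\}.$$ For $D=X$ or $D=L(X)$, a \emph{price function} on $D$ is a functional $\pi:D\to\mathbb R$ that is positively homogeneous and subadditive (whenever the payoffs involved lie in $D$), with $\pi(1)=1$, $\pi(x)\ge\pi(y)$ whenever $x,y\in D$ and $x\ge_* y$, and $\pi(x)>0$ whenever $x\in D$ and $x>_*0$. It is \emph{cash additive} if $\pi(x+a)=\pi(x)+a$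 whenever $x\in D$, $a\in\mathbb R$ and $x+a\in D$. Let $\pi$ be a price function on $X$. A \emph{completion} of the market $(X,\ge_*,\pi)$ is a price function $\rho$ on $L(X)$ with $\rho(x)\le\pi(x)$ for all $x\in X$. The \emph{market power} of $\rho$ is $$\mathrm{ma}(\rho)=\sup\frac{\sum_{i\le N}\rho(f_i)-\rho\big(\sum_{i\le N}f_i\big)}{\sum_{i\le N}\rho(f_i)},\qquad \tfrac00:=0,$$ the supremum being over all finite sequences $f_1,\dots,f_N$ of nonnegative functions in $B(\Omega)$. Let $M(\pi)$ be the set of finitely additive probabilities $m$ on the power set of $\Omega$ such that $L(X)\subset L^1(m)$ (in the sense of Dunford and Schwartz), $\int x\,dm\le\pi(x)$ for every $x\in X$, and $\int(f\wedge1)\,dm>0$ for every $f\in F(\Omega)$ with $f>_*0$. **Theorem.** $M(\pi)\neq\emptyset$ if and only if the market $(X,\ge_*,\pi)$ admits a cash-additive completion $\rho$ with $\mathrm{ma}(\rho)<1$. -/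

import Mathlib

open Filter MeasureTheory
open scoped Topology NNReal

noncomputable section

namespace CommonOrderMarket

/-! ### Finitely additive measures on the power set and their integral

`AddContent ℝ≥0 Set.univ` is Mathlib's type of finitely additive, nonnegative, finite set functions
defined on all subsets of `Ω`. -/

/-- A finitely additive probability on the power set of `Ω`. -/
def IsFinAddProb {Ω : Type*} (m : AddContent ℝ≥0 (Set.univ : Set (Set Ω))) : Prop :=
  m Set.univ = 1

/-- A simple function: one that takes only finitely many values. -/
def IsSimple {Ω : Type*} (s : Ω → ℝ) : Prop := (Set.range s).Finite

/-- The integral of a simple function, `∑ y · m (s = y)` over the values `y` of `s`. -/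
def simpleIntegral {Ω : Type*} (m : AddContent ℝ≥0 (Set.univ : Set (Set Ω))) (s : Ω → ℝ) : ℝ :=
  ∑ᶠ y : ℝ, y * (m (s ⁻¹' {y}) : ℝ)

/-- The Dunford–Schwartz integral: `∫ f dm = I` if there is a sequence of simple functions that
converges to `f` in `m`-measure, is Cauchy in `L¹(m)`, and has integrals converging to `I`. -/
def HasIntegral {Ω : Type*} (m : AddContent ℝ≥0 (Set.univ : Set (Set Ω)))
    (f : Ω → ℝ) (I : ℝ) : Prop :=
  ∃ s : ℕ → Ω → ℝ, (∀ n, IsSimple (s n)) ∧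
    (∀ ε : ℝ, 0 < ε → Tendsto (fun n => m {ω | ε < |s n ω - f ω|}) atTop (𝓝 0)) ∧
    (∀ ε : ℝ, 0 < ε → ∃ N, ∀ j ≥ N, ∀ k ≥ N,
      simpleIntegral m (fun ω => |s j ω - s k ω|) < ε) ∧
    Tendsto (fun n => simpleIntegral m (s n)) atTop (𝓝 I)

/-- `f ∈ L¹(m)`. -/
def IsIntegrable {Ω : Type*} (m : AddContent ℝ≥0 (Set.univ : Set (Set Ω))) (f : Ω → ℝ) : Prop :=
  ∃ I, HasIntegral m f I

open Classical in
/-- The integral `∫ f dm` of `f ∈ L¹(m)` (and `0` if `f ∉ L¹(m)`); it does not depend on the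
approximating sequence, see `HasIntegral.unique`. -/
def integral {Ω : Type*} (m : AddContent ℝ≥0 (Set.univ : Set (Set Ω))) (f : Ω → ℝ) : ℝ :=
  if h : IsIntegrable m f then h.choose else 0

theorem addContent_mono' {Ω : Type*} (m : AddContent ℝ≥0 (Set.univ : Set (Set Ω)))
    {A B : Set Ω} (h : A ⊆ B) : m A ≤ m B := by
  have h1 : m (A ∪ B \ A) = m A + m (B \ A) :=
    addContent_union' (Set.mem_univ _) (Set.mem_univ _) (Set.mem_univ _) disjoint_sdiff_self_right
  rw [Set.union_sdiff_cancel h] at h1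
  rw [h1]
  exact le_self_add

/-- The integral of a simple function that factors through a map with finitely many values. -/
theorem simpleIntegral_comp {Ω ι : Type*} (m : AddContent ℝ≥0 (Set.univ : Set (Set Ω)))
    (p : Ω → ι) (hp : (Set.range p).Finite) (g : ι → ℝ) :
    simpleIntegral m (fun ω => g (p ω)) = ∑ i ∈ hp.toFinset, g i * (m (p ⁻¹' {i}) : ℝ) := by
  classical
  have hsub : (Function.support fun y : ℝ => y * (m ((fun ω => g (p ω)) ⁻¹' {y}) : ℝ)) ⊆
      ((hp.toFinset.image g : Finset ℝ) : Set ℝ) := by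
    intro y hy
    by_contra hne
    apply hy
    have : (fun ω => g (p ω)) ⁻¹' {y} = ∅ := by
      ext ω
      simp only [Set.mem_preimage, Set.mem_singleton_iff, Set.mem_empty_iff_false, iff_false]
      intro h
      apply hne
      simp only [Finset.coe_image, Set.Finite.coe_toFinset]
      exact ⟨p ω, ⟨ω, rfl⟩, h⟩
    simp [this]
  rw [simpleIntegral, finsum_eq_sum_of_support_subset _ hsub,
    ← Finset.sum_fiberwise_of_maps_to (g := g) (t := hp.toFinset.image g)
      (fun i hi => Finset.mem_image_of_mem g hi)]
  refine Finset.sum_congr rfl fun y _ => ?_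
  have hU : (fun ω => g (p ω)) ⁻¹' {y} =
      ⋃ i ∈ hp.toFinset.filter (fun i => g i = y), p ⁻¹' {i} := by
    ext ω
    simp
  have hadd : m (⋃ i ∈ hp.toFinset.filter (fun i => g i = y), p ⁻¹' {i}) =
      ∑ i ∈ hp.toFinset.filter (fun i => g i = y), m (p ⁻¹' {i}) := by
    refine addContent_biUnion (fun _ _ => Set.mem_univ _) ?_ (Set.mem_univ _)
    intro i _ j _ hij
    exact Disjoint.preimage p (by simpa using hij)
  rw [hU, hadd, NNReal.coe_sum, Finset.mul_sum]
  refine Finset.sum_congr rfl fun i hi => ?_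
  rw [(Finset.mem_filter.1 hi).2]

/-- Monotonicity and subadditivity of the integral of simple functions: if `a ≤ b + c` then
`∫ a ≤ ∫ b + ∫ c`. -/
theorem simpleIntegral_le_add {Ω : Type*} (m : AddContent ℝ≥0 (Set.univ : Set (Set Ω)))
    {a b c : Ω → ℝ} (ha : IsSimple a) (hb : IsSimple b) (hc : IsSimple c)
    (h : ∀ ω, a ω ≤ b ω + c ω) :
    simpleIntegral m a ≤ simpleIntegral m b + simpleIntegral m c := by
  have hp : (Set.range fun ω => (a ω, b ω, c ω)).Finite := by
    refine (ha.prod (hb.prod hc)).subset ?_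
    rintro _ ⟨ω, rfl⟩
    exact ⟨⟨ω, rfl⟩, ⟨ω, rfl⟩, ⟨ω, rfl⟩⟩
  have h1 := simpleIntegral_comp m _ hp (fun i => i.1)
  have h2 := simpleIntegral_comp m _ hp (fun i => i.2.1)
  have h3 := simpleIntegral_comp m _ hp (fun i => i.2.2)
  change simpleIntegral m a = _ at h1
  change simpleIntegral m b = _ at h2
  change simpleIntegral m c = _ at h3
  rw [h1, h2, h3, ← Finset.sum_add_distrib]
  refine Finset.sum_le_sum fun i hi => ?_
  rw [← add_mul]
  refine mul_le_mul_of_nonneg_right ?_ (NNReal.coe_nonneg _)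
  obtain ⟨ω, rfl⟩ := hp.mem_toFinset.1 hi
  exact h ω

theorem IsSimple.map₂ {Ω : Type*} {a b : Ω → ℝ} (ha : IsSimple a) (hb : IsSimple b)
    (g : ℝ → ℝ → ℝ) : IsSimple (fun ω => g (a ω) (b ω)) := by
  refine ((ha.prod hb).image fun q : ℝ × ℝ => g q.1 q.2).subset ?_
  rintro _ ⟨ω, rfl⟩
  exact ⟨(a ω, b ω), ⟨⟨ω, rfl⟩, ⟨ω, rfl⟩⟩, rfl⟩

theorem simpleIntegral_indicator {Ω : Type*} (m : AddContent ℝ≥0 (Set.univ : Set (Set Ω)))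
    (A : Set Ω) (K : ℝ) :
    IsSimple (A.indicator fun _ => K) ∧
      simpleIntegral m (A.indicator fun _ => K) = K * (m A : ℝ) := by
  classical
  have hp : (Set.range fun ω => (ω ∈ A : Prop)).Finite := Set.toFinite _
  have h1 := simpleIntegral_comp m _ hp (fun q => if q then K else 0)
  have h2 : (A.indicator fun _ => K) = fun ω => if ω ∈ A then K else 0 := by
    ext ω; simp [Set.indicator_apply]
  refine ⟨?_, ?_⟩
  · rw [h2]
    refine (hp.image fun q : Prop => if q then K else 0).subset ?_
    rintro _ ⟨ω, rfl⟩
    exact ⟨ω ∈ A, ⟨ω, rfl⟩, rfl⟩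
  · rw [h2, h1]
    rcases Set.eq_empty_or_nonempty A with rfl | ⟨ω₀, hω₀⟩
    · rw [addContent_empty, NNReal.coe_zero, mul_zero]
      refine Finset.sum_eq_zero fun i hi => ?_
      obtain ⟨ω, rfl⟩ := hp.mem_toFinset.1 hi
      simp
    · have hT : True ∈ hp.toFinset := hp.mem_toFinset.2 ⟨ω₀, by simp [hω₀]⟩
      rw [Finset.sum_eq_single_of_mem _ hT]
      · have : (fun ω => (ω ∈ A : Prop)) ⁻¹' {True} = A := by ext ω; simp
        rw [this]; simp
      · intro q _ hq
        have : ¬ q := fun h => hq (eq_true h)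
        simp [this]

/-- The Dunford–Schwartz integral is well defined. -/
theorem HasIntegral.unique {Ω : Type*} {m : AddContent ℝ≥0 (Set.univ : Set (Set Ω))}
    {f : Ω → ℝ} {I J : ℝ} (hI : HasIntegral m f I) (hJ : HasIntegral m f J) : I = J := by
  suffices key : ∀ {I J : ℝ}, HasIntegral m f I → HasIntegral m f J → I ≤ J from
    le_antisymm (key hI hJ) (key hJ hI)
  clear hI hJ I J
  rintro I J ⟨s, hs, hsm, hsc, hsI⟩ ⟨t, ht, htm, htc, htJ⟩
  set M : ℝ := (m Set.univ : ℝ) with hM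
  have hM0 : 0 ≤ M := NNReal.coe_nonneg _
  refine le_of_forall_pos_le_add fun ε hε => ?_
  obtain ⟨N₁, hN₁⟩ := hsc (ε / 4) (by positivity)
  obtain ⟨N₂, hN₂⟩ := htc (ε / 4) (by positivity)
  set N := max N₁ N₂
  set δ : ℝ := ε / (8 * (M + 1)) with hδ
  have hδ0 : 0 < δ := by positivity
  obtain ⟨K₀, hK₀⟩ : BddAbove (Set.range fun ω => |s N ω - t N ω|) :=
    ((hs N).map₂ (ht N) fun x y => |x - y|).bddAbove
  set K := max K₀ 0
  have hK : ∀ ω, |s N ω - t N ω| ≤ K := fun ω => (hK₀ ⟨ω, rfl⟩).trans (le_max_left _ _)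
  -- the sets on which `s n` and `t n` are far from `f`
  have hlim : Tendsto (fun n => simpleIntegral m (t n) + (ε / 4 + (ε / 4 +
      (K * (m {ω | δ < |s n ω - f ω|} : ℝ) + (K * (m {ω | δ < |t n ω - f ω|} : ℝ) +
        2 * δ * M))))) atTop
      (𝓝 (J + (ε / 4 + (ε / 4 + (K * ((0 : ℝ≥0) : ℝ) + (K * ((0 : ℝ≥0) : ℝ) + 2 * δ * M)))))) := by
    have e1 := (NNReal.tendsto_coe.2 (hsm δ hδ0)).const_mul K
    have e2 := (NNReal.tendsto_coe.2 (htm δ hδ0)).const_mul K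
    exact htJ.add (((e1.add (e2.add tendsto_const_nhds)).const_add _).const_add _)
  have hle : I ≤ J + (ε / 4 + (ε / 4 + (K * ((0 : ℝ≥0) : ℝ) +
      (K * ((0 : ℝ≥0) : ℝ) + 2 * δ * M)))) := by
    refine le_of_tendsto_of_tendsto hsI hlim ?_
    filter_upwards [eventually_ge_atTop N] with n hn
    have i1 := hN₁ n (le_trans (le_max_left _ _) hn) N (le_max_left _ _)
    have i2 := hN₂ n (le_trans (le_max_right _ _) hn) N (le_max_right _ _)
    obtain ⟨u1, v1⟩ := simpleIntegral_indicator m {ω | δ < |s n ω - f ω|} K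
    obtain ⟨u2, v2⟩ := simpleIntegral_indicator m {ω | δ < |t n ω - f ω|} K
    obtain ⟨u3, v3⟩ := simpleIntegral_indicator m Set.univ (2 * δ)
    have w1 := (hs n).map₂ (hs N) fun x y => |x - y|
    have w2 := (ht n).map₂ (ht N) fun x y => |x - y|
    have w23 := u2.map₂ u3 fun x y => x + y
    have w123 := u1.map₂ w23 fun x y => x + y
    have x2 := w2.map₂ w123 fun x y => x + y
    have x1 := w1.map₂ x2 fun x y => x + y
    have p1 := simpleIntegral_le_add m (hs n) (ht n) x1 ?_
    · have p2 := simpleIntegral_le_add m x1 w1 x2 fun _ => le_rfl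
      have p3 := simpleIntegral_le_add m x2 w2 w123 fun _ => le_rfl
      have p4 := simpleIntegral_le_add m w123 u1 w23 fun _ => le_rfl
      have p5 := simpleIntegral_le_add m w23 u2 u3 fun _ => le_rfl
      rw [← hM] at v3
      linarith
    · intro ω
      have hKω := hK ω
      have hK0 : 0 ≤ K := le_max_right _ _
      have a1 := abs_sub_le (s n ω) (s N ω) (t n ω)
      have a2 := abs_sub_le (s N ω) (t N ω) (t n ω)
      have a3 := abs_sub_comm (t n ω) (t N ω)
      have a4 := le_abs_self (s n ω - t n ω)
      have a5 := abs_sub_le (s n ω) (f ω) (t n ω)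
      have a6 := abs_sub_comm (f ω) (t n ω)
      have b1 := abs_nonneg (s n ω - s N ω)
      have b2 := abs_nonneg (t n ω - t N ω)
      by_cases c1 : δ < |s n ω - f ω| <;> by_cases c2 : δ < |t n ω - f ω| <;>
        simp only [Set.indicator_apply, Set.mem_ofPred_eq, c1, c2, Set.mem_univ, if_true,
          if_false] <;> linarith
  have hδM : 2 * δ * M ≤ ε / 4 := by
    have : 2 * δ * (M + 1) = ε / 4 := by
      rw [hδ]; field_simp; ring
    nlinarith
  simp only [NNReal.coe_zero, mul_zero, zero_add] at hle
  linarith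

theorem HasIntegral.integral_eq {Ω : Type*} {m : AddContent ℝ≥0 (Set.univ : Set (Set Ω))}
    {f : Ω → ℝ} {I : ℝ} (h : HasIntegral m f I) : integral m f = I := by
  have h' : IsIntegrable m f := ⟨I, h⟩
  rw [integral, dif_pos h']
  exact h'.choose_spec.unique h

/-! ### The common order -/

/-- The class `B(Ω)` of bounded functions. -/
def IsBdd {Ω : Type*} (f : Ω → ℝ) : Prop := ∃ C : ℝ, ∀ ω, |f ω| ≤ C

/-- The asymmetric part of a relation: `f >_* g`. Here `ge f g` stands for `f ≥_* g`. -/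
def StrictPart {Ω : Type*} (ge : (Ω → ℝ) → (Ω → ℝ) → Prop) (f g : Ω → ℝ) : Prop :=
  ge f g ∧ ¬ ge g f

/-- The criterion of collective rationality: a transitive and reflexive relation `≥_*` on the real
functions on `Ω`, nontrivial, compatible with the pointwise order and with bounded nonnegative
multipliers and translations, and with truncation. -/
structure IsCommonOrder {Ω : Type*} (ge : (Ω → ℝ) → (Ω → ℝ) → Prop) : Prop where
  refl : ∀ f, ge f f
  trans : ∀ f g h, ge f g → ge g h → ge f h
  one_gt_zero : StrictPart ge 1 0
  of_pointwise : ∀ f g : Ω → ℝ, g ≤ f → ge f g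
  affine : ∀ f g b h : Ω → ℝ, ge f g → IsBdd b → 0 ≤ b → ge (b * f + h) (b * g + h)
  trunc : ∀ f, StrictPart ge f 0 → StrictPart ge (f ⊓ 1) 0

/-! ### Assets and prices -/

/-- The set of payoffs of the traded assets. -/
structure IsAssetSet {Ω : Type*} (ge : (Ω → ℝ) → (Ω → ℝ) → Prop) (X : Set (Ω → ℝ)) : Prop where
  convex : Convex ℝ X
  zero_mem : (0 : Ω → ℝ) ∈ X
  one_mem : (1 : Ω → ℝ) ∈ X
  bounded_loss : ∀ f ∈ X, ∃ a : ℝ, ge f (fun _ => a)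
  add_cash_mem : ∀ f ∈ X, ∀ c : ℝ, 0 ≤ c → (f + fun _ => c) ∈ X

/-- The complete market `L(X)`: all `g` with `c • x ≥_* |g|` for some `c > 0` and `x ∈ X`. -/
def completeMarket {Ω : Type*} (ge : (Ω → ℝ) → (Ω → ℝ) → Prop) (X : Set (Ω → ℝ)) :
    Set (Ω → ℝ) :=
  {g | ∃ c : ℝ, 0 < c ∧ ∃ x ∈ X, ge (c • x) |g|}

/-- `π ∈ Π(D)`: a price function on the set of payoffs `D`, free of arbitrage. Only the values of
`π` on `D` matter. -/
structure IsPriceFunction {Ω : Type*} (ge : (Ω → ℝ) → (Ω → ℝ) → Prop) (D : Set (Ω → ℝ))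
    (π : (Ω → ℝ) → ℝ) : Prop where
  pos_homogeneous : ∀ x ∈ D, ∀ c : ℝ, 0 ≤ c → c • x ∈ D → π (c • x) = c * π x
  subadditive : ∀ x ∈ D, ∀ y ∈ D, x + y ∈ D → π (x + y) ≤ π x + π y
  map_one : π 1 = 1
  mono : ∀ x ∈ D, ∀ y ∈ D, ge x y → π y ≤ π x
  no_arbitrage : ∀ x ∈ D, StrictPart ge x 0 → 0 < π x

/-- Cash additivity of `π` on the set of payoffs `D`. -/
def IsCashAdditive {Ω : Type*} (D : Set (Ω → ℝ)) (π : (Ω → ℝ) → ℝ) : Prop :=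
  ∀ x ∈ D, ∀ a : ℝ, (x + fun _ => a) ∈ D → π (x + fun _ => a) = π x + a

/-- `(L(X), ≥_*, ρ)` is a completion of the market `(X, ≥_*, π)`: `ρ ∈ Π(L(X))` and `ρ ≤ π`
on `X`. -/
def IsCompletion {Ω : Type*} (ge : (Ω → ℝ) → (Ω → ℝ) → Prop) (X : Set (Ω → ℝ))
    (π ρ : (Ω → ℝ) → ℝ) : Prop :=
  IsPriceFunction ge (completeMarket ge X) ρ ∧ ∀ x ∈ X, ρ x ≤ π x

/-! ### Pricing measures and market power -/

/-- The pricing measures `M₀(π)`. -/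
def pricingMeasures {Ω : Type*} (ge : (Ω → ℝ) → (Ω → ℝ) → Prop) (X : Set (Ω → ℝ))
    (π : (Ω → ℝ) → ℝ) : Set (AddContent ℝ≥0 (Set.univ : Set (Set Ω))) :=
  {m | IsFinAddProb m ∧ (∀ g ∈ completeMarket ge X, IsIntegrable m g) ∧
    ∀ x ∈ X, integral m x ≤ π x}

/-- The strictly positive pricing measures `M(π)`. -/
def strictPricingMeasures {Ω : Type*} (ge : (Ω → ℝ) → (Ω → ℝ) → Prop) (X : Set (Ω → ℝ))
    (π : (Ω → ℝ) → ℝ) : Set (AddContent ℝ≥0 (Set.univ : Set (Set Ω))) :=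
  {m | m ∈ pricingMeasures ge X π ∧ ∀ f, StrictPart ge f 0 → 0 < integral m (f ⊓ 1)}

/-- The relative markdown on the bundle `f₁ + ⋯ + f_N`; division in `ℝ` obeys `0 / 0 = 0`. -/
def bundleMarketPower {Ω : Type*} (ρ : (Ω → ℝ) → ℝ) {N : ℕ} (f : Fin N → Ω → ℝ) : ℝ :=
  (∑ i, ρ (f i) - ρ (∑ i, f i)) / ∑ i, ρ (f i)

/-- The market power of `ρ`: the supremum, in the extended reals, over all finite sequences of
nonnegative bounded functions. -/
def marketPower {Ω : Type*} (ρ : (Ω → ℝ) → ℝ) : EReal :=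
  ⨆ (N : ℕ) (f : Fin N → Ω → ℝ) (_ : ∀ i, 0 ≤ f i ∧ IsBdd (f i)), (bundleMarketPower ρ f : EReal)

end CommonOrderMarket

end

namespace CommonOrderMarket

/-! ### Linearity and positivity of the Dunford–Schwartz integral -/

section Integral

variable {Ω : Type*} {m : AddContent ℝ≥0 (Set.univ : Set (Set Ω))}

/-! From a measure to a completion: integration against `m` in `M(π)` is itself the completion. If
the indicator of `A` is negligible but `m A > 0`, then `1 - 1_A / m A` is strictly positive for the
order and at most `1`, yet has integral `0`; so strict positivity forces `m` to vanish on negligible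
sets, and the integral respects `≥_*`. Being linear, it has no positive market power.

From a completion to a measure: `ma(ρ) < 1` gives `c > 0` such that `ρ(∑ fᵢ) ≥ c ∑ ρ(fᵢ)` for
nonnegative bounded `fᵢ`. The pairs (bundle, `c` times the total price of its parts) form a convex
cone lying below the sublinear `ρ`, so Hahn–Banach (`exists_linear_sandwich`) gives a linear `ψ ≤ ρ`
on `L(X)` with `c ρ ≤ ψ` on nonnegative bounded functions. Cash additivity gives `ψ 1 = 1`, and `m A
= ψ(1_A)` is the required measure.

The functional `ψ` may carry a part invisible to bounded functions, so an unbounded `g ≥ 0` only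
satisfies `∫ g dm ≤ ψ g` (`exists_hasIntegral_contentOfFunctional`). This is the direction needed
for `∫ x dm ≤ π x`, because each asset is bounded below up to a negligible function. Strict
positivity involves only the bounded function `(f ∧ 1)⁺`, where integral and `ψ` agree and `ψ ≥ c ρ
> 0`. -/

theorem isSetRing_univ (Ω : Type*) : IsSetRing (Set.univ : Set (Set Ω)) :=
  ⟨Set.mem_univ _, fun _ _ _ _ => Set.mem_univ _, fun _ _ _ _ => Set.mem_univ _⟩

/-- If `A n ⊆ B n ∪ C n` and the contents of `B n` and `C n` tend to zero, so do those of
`A n`. -/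
theorem tendsto_content_of_subset_union {A B C : ℕ → Set Ω}
    (h : ∀ᶠ n in atTop, A n ⊆ B n ∪ C n) (hB : Tendsto (fun n => m (B n)) atTop (𝓝 0))
    (hC : Tendsto (fun n => m (C n)) atTop (𝓝 0)) :
    Tendsto (fun n => m (A n)) atTop (𝓝 0) := by
  have hBC : Tendsto (fun n => m (B n) + m (C n)) atTop (𝓝 0) := by simpa using hB.add hC
  refine tendsto_of_tendsto_of_tendsto_of_le_of_le' tendsto_const_nhds hBC
    (Eventually.of_forall fun _ => zero_le) ?_
  filter_upwards [h] with n hn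
  exact (addContent_mono' m hn).trans
    (addContent_union_le (isSetRing_univ Ω) (Set.mem_univ _) (Set.mem_univ _))

theorem IsSimple.map {a : Ω → ℝ} (ha : IsSimple a) (g : ℝ → ℝ) : IsSimple fun ω => g (a ω) :=
  ha.map₂ ha fun x _ => g x

theorem simpleIntegral_add {a b : Ω → ℝ} (ha : IsSimple a) (hb : IsSimple b) :
    simpleIntegral m (fun ω => a ω + b ω) = simpleIntegral m a + simpleIntegral m b := by
  have hp : (Set.range fun ω => (a ω, b ω)).Finite := by
    refine (ha.prod hb).subset ?_
    rintro _ ⟨ω, rfl⟩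
    exact ⟨⟨ω, rfl⟩, ⟨ω, rfl⟩⟩
  have h1 := simpleIntegral_comp m _ hp (fun i => i.1)
  have h2 := simpleIntegral_comp m _ hp (fun i => i.2)
  have h3 := simpleIntegral_comp m _ hp (fun i => i.1 + i.2)
  change simpleIntegral m a = _ at h1
  change simpleIntegral m b = _ at h2
  rw [h1, h2, h3, ← Finset.sum_add_distrib]
  exact Finset.sum_congr rfl fun i _ => add_mul _ _ _

theorem simpleIntegral_const_mul {a : Ω → ℝ} (ha : IsSimple a) (c : ℝ) :
    simpleIntegral m (fun ω => c * a ω) = c * simpleIntegral m a := by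
  have h1 := simpleIntegral_comp m a ha (fun i => i)
  have h2 := simpleIntegral_comp m a ha (fun i => c * i)
  change simpleIntegral m a = _ at h1
  rw [h1, h2, Finset.mul_sum]
  exact Finset.sum_congr rfl fun i _ => mul_assoc _ _ _

theorem simpleIntegral_nonneg {a : Ω → ℝ} (h : ∀ ω, 0 ≤ a ω) : 0 ≤ simpleIntegral m a := by
  refine finsum_nonneg fun y => ?_
  rcases Set.eq_empty_or_nonempty (a ⁻¹' {y}) with hy | ⟨ω, hω⟩
  · simp [hy]
  · have : a ω = y := hω
    exact mul_nonneg (this ▸ h ω) (NNReal.coe_nonneg _)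

theorem simpleIntegral_mono {a b : Ω → ℝ} (ha : IsSimple a) (hb : IsSimple b)
    (h : ∀ ω, a ω ≤ b ω) : simpleIntegral m a ≤ simpleIntegral m b := by
  have h1 := simpleIntegral_add (m := m) ha (hb.map₂ ha fun x y => x - y)
  have h2 : 0 ≤ simpleIntegral m fun ω => b ω - a ω :=
    simpleIntegral_nonneg fun ω => sub_nonneg.2 (h ω)
  simp only [add_sub_cancel] at h1
  linarith

theorem abs_simpleIntegral_sub_le {a b : Ω → ℝ} (ha : IsSimple a) (hb : IsSimple b) :
    |simpleIntegral m a - simpleIntegral m b| ≤ simpleIntegral m fun ω => |a ω - b ω| := by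
  have h1 := simpleIntegral_le_add m ha hb (ha.map₂ hb fun x y => |x - y|)
    fun ω => by linarith [le_abs_self (a ω - b ω)]
  have h2 := simpleIntegral_le_add m hb ha (ha.map₂ hb fun x y => |x - y|)
    fun ω => by linarith [neg_abs_le (a ω - b ω)]
  rw [abs_sub_le_iff]
  exact ⟨by linarith, by linarith⟩

theorem HasIntegral.of_isSimple {f : Ω → ℝ} (hf : IsSimple f) :
    HasIntegral m f (simpleIntegral m f) := by
  refine ⟨fun _ => f, fun _ => hf, fun ε hε => ?_, fun ε hε => ⟨0, fun _ _ _ _ => ?_⟩,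
    tendsto_const_nhds⟩
  · simp [not_lt.2 hε.le]
  · have h := (simpleIntegral_indicator m (∅ : Set Ω) 0).2
    simp only [Set.indicator_empty, zero_mul] at h
    simpa [h] using hε

theorem HasIntegral.indicator (A : Set Ω) (K : ℝ) :
    HasIntegral m (A.indicator fun _ => K) (K * (m A : ℝ)) := by
  obtain ⟨h1, h2⟩ := simpleIntegral_indicator m A K
  exact h2 ▸ HasIntegral.of_isSimple h1

theorem HasIntegral.const (hm : IsFinAddProb m) (K : ℝ) : HasIntegral m (fun _ => K) K := by
  have h := HasIntegral.indicator (m := m) Set.univ K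
  have h1 : m Set.univ = 1 := hm
  simpa [h1] using h

theorem HasIntegral.add {f g : Ω → ℝ} {I J : ℝ} (hf : HasIntegral m f I)
    (hg : HasIntegral m g J) : HasIntegral m (f + g) (I + J) := by
  obtain ⟨s, hs, hsm, hsc, hsI⟩ := hf
  obtain ⟨t, ht, htm, htc, htJ⟩ := hg
  refine ⟨fun n ω => s n ω + t n ω, fun n => (hs n).map₂ (ht n) fun x y => x + y,
    fun ε hε => ?_, fun ε hε => ?_, ?_⟩
  · refine tendsto_content_of_subset_union (Eventually.of_forall fun n ω hω => ?_)
      (hsm (ε / 2) (half_pos hε)) (htm (ε / 2) (half_pos hε))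
    by_contra hne
    simp only [Set.mem_union, Set.mem_ofPred_eq, not_or, not_lt, Pi.add_apply] at hne hω
    have := abs_add_le (s n ω - f ω) (t n ω - g ω)
    rw [show s n ω - f ω + (t n ω - g ω) = s n ω + t n ω - (f ω + g ω) by ring] at this
    linarith [hne.1, hne.2]
  · obtain ⟨N₁, h₁⟩ := hsc (ε / 2) (half_pos hε)
    obtain ⟨N₂, h₂⟩ := htc (ε / 2) (half_pos hε)
    refine ⟨max N₁ N₂, fun j hj k hk => ?_⟩
    have i₁ := h₁ j (le_of_max_le_left hj) k (le_of_max_le_left hk)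
    have i₂ := h₂ j (le_of_max_le_right hj) k (le_of_max_le_right hk)
    have := simpleIntegral_le_add m
      (((hs j).map₂ (ht j) fun x y => x + y).map₂ ((hs k).map₂ (ht k) fun x y => x + y)
        fun x y => |x - y|)
      ((hs j).map₂ (hs k) fun x y => |x - y|) ((ht j).map₂ (ht k) fun x y => |x - y|)
      fun ω => by
        rw [show s j ω + t j ω - (s k ω + t k ω) = s j ω - s k ω + (t j ω - t k ω) by ring]
        exact abs_add_le _ _
    linarith
  · simpa only [simpleIntegral_add (hs _) (ht _)] using hsI.add htJ

theorem HasIntegral.smul {f : Ω → ℝ} {I : ℝ} (hf : HasIntegral m f I) (c : ℝ) :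
    HasIntegral m (c • f) (c * I) := by
  obtain ⟨s, hs, hsm, hsc, hsI⟩ := hf
  -- The summand `1` allows division also when `c = 0`.
  have hc : 0 < |c| + 1 := by positivity
  refine ⟨fun n ω => c * s n ω, fun n => (hs n).map fun x => c * x, fun ε hε => ?_,
    fun ε hε => ?_, ?_⟩
  · refine tendsto_content_of_subset_union (Eventually.of_forall fun n ω hω => ?_)
      (hsm (ε / (|c| + 1)) (div_pos hε hc)) (hsm (ε / (|c| + 1)) (div_pos hε hc))
    left
    simp only [Set.mem_ofPred_eq, Pi.smul_apply, smul_eq_mul, ← mul_sub, abs_mul] at hω ⊢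
    rw [div_lt_iff₀ hc]
    nlinarith [abs_nonneg (s n ω - f ω)]
  · obtain ⟨N, h⟩ := hsc (ε / (|c| + 1)) (div_pos hε hc)
    refine ⟨N, fun j hj k hk => ?_⟩
    have i := h j hj k hk
    have h0 : 0 ≤ simpleIntegral m fun ω => |s j ω - s k ω| :=
      simpleIntegral_nonneg fun _ => abs_nonneg _
    rw [lt_div_iff₀ hc] at i
    simp only [← mul_sub, abs_mul]
    rw [simpleIntegral_const_mul ((hs j).map₂ (hs k) fun x y => |x - y|)]
    nlinarith
  · simpa only [simpleIntegral_const_mul (hs _)] using hsI.const_mul c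

theorem HasIntegral.sub {f g : Ω → ℝ} {I J : ℝ} (hf : HasIntegral m f I)
    (hg : HasIntegral m g J) : HasIntegral m (f - g) (I - J) := by
  have := hf.add (hg.smul (-1))
  simpa only [neg_smul, one_smul, neg_mul, one_mul, ← sub_eq_add_neg] using this

/-- The integral of a function whose negative part is null is nonnegative. -/
theorem HasIntegral.nonneg {f : Ω → ℝ} {I : ℝ} (hf : HasIntegral m f I)
    (h0 : ∀ ε : ℝ, 0 < ε → m {ω | f ω < -ε} = 0) : 0 ≤ I := by
  have hf' := hf
  obtain ⟨s, hs, hsm, hsc, hsI⟩ := hf'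
  have ht : ∀ n, IsSimple fun ω => max (s n ω) 0 := fun n => (hs n).map fun x => max x 0
  have hcau : ∀ ε : ℝ, 0 < ε → ∃ N, ∀ j ≥ N, ∀ k ≥ N,
      simpleIntegral m (fun ω => |max (s j ω) 0 - max (s k ω) 0|) < ε := by
    intro ε hε
    obtain ⟨N, h⟩ := hsc ε hε
    refine ⟨N, fun j hj k hk => lt_of_le_of_lt ?_ (h j hj k hk)⟩
    exact simpleIntegral_mono ((ht j).map₂ (ht k) fun x y => |x - y|)
      ((hs j).map₂ (hs k) fun x y => |x - y|) fun ω => abs_max_sub_max_le_abs _ _ _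
  obtain ⟨I', hI'⟩ := cauchySeq_tendsto_of_complete
    (u := fun n => simpleIntegral m fun ω => max (s n ω) 0) <| by
      refine Metric.cauchySeq_iff.2 fun ε hε => ?_
      obtain ⟨N, h⟩ := hcau ε hε
      exact ⟨N, fun j hj k hk =>
        (abs_simpleIntegral_sub_le (ht j) (ht k)).trans_lt (h j hj k hk)⟩
  -- The truncated simple functions approximate `f⁺`, which differs from `f` by more than `ε / 2`
  -- only on a null set; hence they also compute the integral of `f`.
  have hfI' : HasIntegral m f I' := by
    refine ⟨fun n ω => max (s n ω) 0, ht, fun ε hε => ?_, hcau, hI'⟩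
    refine tendsto_content_of_subset_union (C := fun _ => {ω | f ω < -(ε / 2)})
      (Eventually.of_forall fun n ω hω => ?_) (hsm (ε / 2) (half_pos hε))
      (by rw [h0 _ (half_pos hε)]; exact tendsto_const_nhds)
    by_contra hne
    simp only [Set.mem_union, Set.mem_ofPred_eq, not_or, not_lt] at hne hω
    obtain ⟨h1, h2⟩ := hne
    have h3 := abs_sub_le (max (s n ω) 0) (max (f ω) 0) (f ω)
    have h4 := abs_max_sub_max_le_abs (s n ω) (f ω) 0
    have h5 : |max (f ω) 0 - f ω| ≤ ε / 2 := by
      rw [abs_le]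
      constructor
      · linarith [le_max_left (f ω) 0]
      · rcases max_cases (f ω) 0 with h | h <;> linarith [h.1]
    linarith
  rw [hf.unique hfI']
  exact ge_of_tendsto' hI' fun n => simpleIntegral_nonneg fun ω => le_max_right _ _

end Integral

/-! ### Finitely additive measures from linear functionals -/

section Representation

variable {Ω : Type*}

theorem isBdd_indicator (A : Set Ω) : IsBdd (A.indicator (1 : Ω → ℝ)) :=
  ⟨1, fun ω => by by_cases h : ω ∈ A <;> simp [h]⟩

/-- The finitely additive measure `A ↦ ψ (1_A)`. -/
noncomputable def contentOfFunctional (ψ : (Ω → ℝ) →ₗ[ℝ] ℝ)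
    (h : ∀ A : Set Ω, 0 ≤ ψ (A.indicator 1)) : AddContent ℝ≥0 (Set.univ : Set (Set Ω)) :=
  (isSetRing_univ Ω).addContent_of_union (fun A => ⟨ψ (A.indicator 1), h A⟩)
    (by
      ext
      change ψ ((∅ : Set Ω).indicator 1) = 0
      rw [Set.indicator_empty']
      exact map_zero ψ)
    (fun {A B} _ _ hd => by
      ext
      change ψ ((A ∪ B).indicator 1) = ψ (A.indicator 1) + ψ (B.indicator 1)
      rw [Set.indicator_union_of_disjoint hd, ← map_add]
      rfl)

theorem coe_contentOfFunctional (ψ : (Ω → ℝ) →ₗ[ℝ] ℝ)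
    (h : ∀ A : Set Ω, 0 ≤ ψ (A.indicator 1)) (A : Set Ω) :
    (contentOfFunctional ψ h A : ℝ) = ψ (A.indicator 1) := rfl

theorem simpleIntegral_contentOfFunctional (ψ : (Ω → ℝ) →ₗ[ℝ] ℝ)
    (h : ∀ A : Set Ω, 0 ≤ ψ (A.indicator 1)) {s : Ω → ℝ} (hs : IsSimple s) :
    simpleIntegral (contentOfFunctional ψ h) s = ψ s := by
  classical
  have h1 := simpleIntegral_comp (contentOfFunctional ψ h) s hs (fun i => i)
  change simpleIntegral _ s = _ at h1
  have h2 : s = ∑ y ∈ hs.toFinset, y • (s ⁻¹' {y}).indicator (1 : Ω → ℝ) := by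
    ext ω
    simp only [Finset.sum_apply, Pi.smul_apply, smul_eq_mul, Set.indicator_apply,
      Set.mem_preimage, Set.mem_singleton_iff, Pi.one_apply, mul_ite, mul_one, mul_zero]
    rw [Finset.sum_ite_eq, if_pos (hs.mem_toFinset.2 ⟨ω, rfl⟩)]
  rw [h1]
  conv_rhs => rw [h2]
  rw [map_sum]
  exact Finset.sum_congr rfl fun y _ => by rw [map_smul, coe_contentOfFunctional, smul_eq_mul]

theorem IsSimple.isBdd {f : Ω → ℝ} (hf : IsSimple f) : IsBdd f := by
  obtain ⟨C, hC⟩ := (hf.map fun x => |x|).bddAbove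
  exact ⟨C, fun ω => hC ⟨ω, rfl⟩⟩

theorem isSimple_floor_div {f : Ω → ℝ} (hf : IsBdd f) (K : ℝ) :
    IsSimple fun ω => (⌊K * f ω⌋ : ℝ) / K := by
  obtain ⟨C, hC⟩ := hf
  refine ((Set.finite_Icc ⌊-(|K| * C)⌋ ⌊|K| * C⌋).image fun z : ℤ => (z : ℝ) / K).subset ?_
  rintro _ ⟨ω, rfl⟩
  have h : |K * f ω| ≤ |K| * C := by
    rw [abs_mul]
    exact mul_le_mul_of_nonneg_left (hC ω) (abs_nonneg _)
  exact ⟨_, ⟨Int.floor_le_floor (abs_le.1 h).1, Int.floor_le_floor (abs_le.1 h).2⟩, rfl⟩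

theorem abs_floor_div_sub_le {K : ℝ} (hK : 0 < K) (x : ℝ) : |(⌊K * x⌋ : ℝ) / K - x| ≤ 1 / K := by
  have h1 := Int.floor_le (K * x)
  have h2 := Int.lt_floor_add_one (K * x)
  rw [show (⌊K * x⌋ : ℝ) / K - x = (⌊K * x⌋ - K * x) / K by field_simp, abs_div, abs_of_pos hK]
  gcongr
  rw [abs_le]
  constructor <;> linarith

variable {E : Submodule ℝ (Ω → ℝ)} {ψ : (Ω → ℝ) →ₗ[ℝ] ℝ}

theorem mem_of_isBdd (hE : ∀ f g : Ω → ℝ, g ∈ E → |f| ≤ |g| → f ∈ E) (h1 : (1 : Ω → ℝ) ∈ E)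
    {f : Ω → ℝ} (hf : IsBdd f) : f ∈ E := by
  obtain ⟨C, hC⟩ := hf
  refine hE f _ (E.smul_mem C h1) fun ω => ?_
  simpa using (hC ω).trans (le_abs_self C)

/-- A positive functional on a solid space of functions that contains the bounded ones induces a
finitely additive measure, for which the nonnegative functions `g` of the space are integrable,
with integral at most `ψ g`, and equal to `ψ g` if `g` is bounded. -/
theorem exists_hasIntegral_contentOfFunctional
    (hE : ∀ f g : Ω → ℝ, g ∈ E → |f| ≤ |g| → f ∈ E) (h1 : (1 : Ω → ℝ) ∈ E)
    (hψ : ∀ f ∈ E, 0 ≤ f → 0 ≤ ψ f) (h : ∀ A : Set Ω, 0 ≤ ψ (A.indicator 1))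
    {g : Ω → ℝ} (hg : g ∈ E) (hg0 : 0 ≤ g) :
    ∃ L, HasIntegral (contentOfFunctional ψ h) g L ∧ L ≤ ψ g ∧ (IsBdd g → L = ψ g) := by
  have hmono : ∀ a ∈ E, ∀ b ∈ E, a ≤ b → ψ a ≤ ψ b := fun a ha b hb hab => by
    have := hψ (b - a) (E.sub_mem hb ha) (sub_nonneg.2 hab)
    rw [map_sub] at this
    linarith
  -- `K n` is both the truncation height and the inverse mesh of the rounding: `u n` cuts `g` at `K
  -- n`, and `s n` rounds `u n` down to multiples of `1 / K n`.
  set K : ℕ → ℝ := fun n => (n : ℝ) + 1 with hK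
  have hK0 : ∀ n, 0 < K n := fun n => by positivity
  have hKmono : Monotone K := fun i j hij => by simp only [hK]; gcongr
  set u : ℕ → Ω → ℝ := fun n ω => min (g ω) (K n) with hu
  have hu0 : ∀ n ω, 0 ≤ u n ω := fun n ω => le_min (hg0 ω) (hK0 n).le
  have hub : ∀ n, IsBdd (u n) := fun n =>
    ⟨K n, fun ω => by rw [abs_of_nonneg (hu0 n ω)]; exact min_le_right _ _⟩
  have huE : ∀ n, u n ∈ E := fun n => mem_of_isBdd hE h1 (hub n)
  have hug : ∀ n, u n ≤ g := fun n ω => min_le_left _ _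
  have humono : Monotone u := fun i j hij ω => min_le_min_left _ (hKmono hij)
  have hψmono : Monotone fun n => ψ (u n) := fun i j hij =>
    hmono _ (huE i) _ (huE j) (humono hij)
  have hψle : ∀ n, ψ (u n) ≤ ψ g := fun n => hmono _ (huE n) _ hg (hug n)
  have hlim := tendsto_atTop_ciSup hψmono ⟨ψ g, by rintro _ ⟨n, rfl⟩; exact hψle n⟩
  set L := ⨆ n, ψ (u n) with hL
  set s : ℕ → Ω → ℝ := fun n ω => (⌊K n * u n ω⌋ : ℝ) / K n with hs_def
  have hs : ∀ n, IsSimple (s n) := fun n => isSimple_floor_div (hub n) _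
  have hsu : ∀ n ω, |s n ω - u n ω| ≤ 1 / K n := fun n ω => abs_floor_div_sub_le (hK0 n) _
  have hsE : ∀ n, s n ∈ E := fun n => mem_of_isBdd hE h1 (hs n).isBdd
  have hψ1 : 0 ≤ ψ 1 := hψ 1 h1 zero_le_one
  have hKinv : Tendsto (fun n => 1 / K n) atTop (𝓝 0) := tendsto_one_div_add_atTop_nhds_zero_nat
  refine ⟨L, ⟨s, hs, fun ε hε => ?_, fun ε hε => ?_, ?_⟩,
    le_of_tendsto' hlim hψle, fun ⟨C, hC⟩ => ?_⟩
  -- Chebyshev's inequality for `ψ`. Off the set `K n < g` nothing is cut, so only the rounding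
  -- error remains.
  · have hbound : ∀ n, ((contentOfFunctional ψ h {ω | K n < g ω} : ℝ≥0) : ℝ) ≤
        ψ g * (1 / K n) := by
      intro n
      rw [coe_contentOfFunctional, mul_one_div, le_div_iff₀ (hK0 n), mul_comm, ← smul_eq_mul,
        ← map_smul]
      refine hmono _ (E.smul_mem _ (mem_of_isBdd hE h1 (isBdd_indicator _))) _ hg fun ω => ?_
      by_cases hω : K n < g ω
      · simp [hω, hω.le]
      · simpa [hω] using hg0 ω
    have hB : Tendsto (fun n => contentOfFunctional ψ h {ω | K n < g ω}) atTop (𝓝 0) := by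
      rw [← NNReal.tendsto_coe]
      refine squeeze_zero (fun n => NNReal.coe_nonneg _) hbound ?_
      simpa using hKinv.const_mul (ψ g)
    refine tendsto_content_of_subset_union ?_ hB hB
    filter_upwards [hKinv.eventually (gt_mem_nhds hε)] with n hn ω hω
    left
    by_contra hne
    have hne' : g ω ≤ K n := not_lt.1 hne
    have h2 := hsu n ω
    rw [show u n ω = g ω from min_eq_left hne'] at h2
    exact absurd (lt_of_lt_of_le hω h2) (not_lt.2 hn.le)
  · have hcau := hlim.cauchySeq
    obtain ⟨N₁, hN₁⟩ := Metric.cauchySeq_iff.1 hcau (ε / 2) (half_pos hε)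
    have hq : Tendsto (fun n => (2 * ψ 1) * (1 / K n)) atTop (𝓝 0) := by
      simpa using hKinv.const_mul (2 * ψ 1)
    obtain ⟨N₂, hN₂⟩ := eventually_atTop.1 (hq.eventually (gt_mem_nhds (half_pos hε)))
    refine ⟨max N₁ N₂, ?_⟩
    -- Since `u` increases, `|s j - s k| ≤ (u k - u j) + 2 / K j`, and `ψ (u n)` is Cauchy because
    -- it is increasing and bounded by `ψ g`.
    have key : ∀ j k, j ≤ k → max N₁ N₂ ≤ j → ψ (fun ω => |s j ω - s k ω|) < ε := by
      intro j k hjk hj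
      have hb : ψ (fun ω => |s j ω - s k ω|) ≤ ψ ((u k - u j) + (2 * (1 / K j)) • 1) := by
        refine hmono _ (mem_of_isBdd hE h1
          ((hs j).map₂ (hs k) fun x y => |x - y|).isBdd) _
          (E.add_mem (E.sub_mem (huE k) (huE j)) (E.smul_mem _ h1)) fun ω => ?_
        have i1 := hsu j ω
        have i2 := hsu k ω
        have i3 : 1 / K k ≤ 1 / K j := one_div_le_one_div_of_le (hK0 j) (hKmono hjk)
        have i4 : u j ω ≤ u k ω := humono hjk ω
        have i5 := abs_le.1 i1
        have i6 := abs_le.1 i2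
        simp only [Pi.add_apply, Pi.sub_apply, Pi.smul_apply, Pi.one_apply, smul_eq_mul, mul_one]
        rw [abs_le]
        constructor <;> linarith [i5.1, i5.2, i6.1, i6.2]
      rw [map_add, map_sub, map_smul, smul_eq_mul] at hb
      have d1 := hN₁ k ((le_of_max_le_left hj).trans hjk) j (le_of_max_le_left hj)
      rw [Real.dist_eq] at d1
      have d2 := hN₂ j (le_of_max_le_right hj)
      have d3 := le_abs_self (ψ (u k) - ψ (u j))
      linarith
    intro j hj k hk
    rw [simpleIntegral_contentOfFunctional ψ h ((hs j).map₂ (hs k) fun x y => |x - y|)]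
    rcases le_total j k with hjk | hkj
    · exact key j k hjk hj
    · simpa only [abs_sub_comm] using key k j hkj hk
  · have hdiff : Tendsto (fun n => ψ (s n) - ψ (u n)) atTop (𝓝 0) := by
      refine squeeze_zero_norm (a := fun n => ψ 1 * (1 / K n)) (fun n => ?_)
        (by simpa using hKinv.const_mul (ψ 1))
      have b1 : ψ (s n - u n) ≤ ψ ((1 / K n) • 1) :=
        hmono _ (E.sub_mem (hsE n) (huE n)) _ (E.smul_mem _ h1) fun ω => by
          simpa using (abs_le.1 (hsu n ω)).2
      have b2 : ψ (-((1 / K n) • 1)) ≤ ψ (s n - u n) :=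
        hmono _ (E.neg_mem (E.smul_mem _ h1)) _ (E.sub_mem (hsE n) (huE n)) fun ω => by
          simpa using (abs_le.1 (hsu n ω)).1
      rw [map_sub, map_smul, smul_eq_mul] at b1
      rw [map_sub, map_neg, map_smul, smul_eq_mul] at b2
      rw [Real.norm_eq_abs, abs_le]
      constructor <;> linarith
    simp only [simpleIntegral_contentOfFunctional ψ h (hs _)]
    simpa using hdiff.add hlim
  -- For bounded `g` the truncations are eventually equal to `g`, so nothing is lost in the limit.
  · refine tendsto_nhds_unique hlim (tendsto_const_nhds.congr' ?_)
    filter_upwards [eventually_ge_atTop ⌈C⌉₊] with n hn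
    congr 1
    ext ω
    refine (min_eq_left ?_).symm
    have c1 : C ≤ n := Nat.ceil_le.1 hn
    have c2 := (le_abs_self (g ω)).trans (hC ω)
    simp only [hK]
    linarith

end Representation

/-! ### A sandwich theorem -/

/-- Let `q` be sublinear and let `P` be (the graph of) a convex cone with `s ≤ q x` for all
`(x, s)` in `P`. Then some linear functional `φ ≤ q` satisfies `s ≤ φ x` for all `(x, s)` in `P`. -/
theorem exists_linear_sandwich {V : Type*} [AddCommGroup V] [Module ℝ V] (q : V → ℝ)
    (hom : ∀ c : ℝ, 0 < c → ∀ x, q (c • x) = c * q x) (add : ∀ x y, q (x + y) ≤ q x + q y)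
    (P : V → ℝ → Prop) (P_zero : P 0 0)
    (P_add : ∀ x s y t, P x s → P y t → P (x + y) (s + t))
    (P_smul : ∀ c : ℝ, 0 < c → ∀ x s, P x s → P (c • x) (c * s))
    (hPq : ∀ x s, P x s → s ≤ q x) :
    ∃ φ : V →ₗ[ℝ] ℝ, (∀ x, φ x ≤ q x) ∧ ∀ x s, P x s → s ≤ φ x := by
  have q_zero : q 0 = 0 := by
    have := hom 2 two_pos 0
    rw [smul_zero] at this
    linarith
  -- The infimum of `S x` is the infimal convolution of `q` with the cone. It is sublinear, and a
  -- linear functional below it satisfies both required bounds.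
  set S : V → Set ℝ := fun x => {r | ∃ y s, P y s ∧ r = q (x + y) - s} with hS
  have hne : ∀ x, (S x).Nonempty := fun x => ⟨_, 0, 0, P_zero, rfl⟩
  have hbdd : ∀ x, BddBelow (S x) := by
    refine fun x => ⟨-q (-x), ?_⟩
    rintro _ ⟨y, s, hy, rfl⟩
    have h1 := add (x + y) (-x)
    rw [show x + y + -x = y by abel] at h1
    linarith [hPq y s hy]
  have hle : ∀ x y s, P y s → sInf (S x) ≤ q (x + y) - s := fun x y s h =>
    csInf_le (hbdd x) ⟨y, s, h, rfl⟩
  have hsub : ∀ x y, sInf (S (x + y)) ≤ sInf (S x) + sInf (S y) := by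
    intro x y
    rw [← sub_le_iff_le_add]
    refine le_csInf (hne x) ?_
    rintro _ ⟨a, s, ha, rfl⟩
    rw [sub_le_comm]
    refine le_csInf (hne y) ?_
    rintro _ ⟨b, t, hb, rfl⟩
    have h1 := hle (x + y) _ _ (P_add a s b t ha hb)
    have h2 := add (x + a) (y + b)
    rw [show x + a + (y + b) = x + y + (a + b) by abel] at h2
    linarith
  have hhom_le : ∀ c : ℝ, 0 < c → ∀ x, sInf (S (c • x)) ≤ c * sInf (S x) := by
    intro c hc x
    rw [← div_le_iff₀' hc]
    refine le_csInf (hne x) ?_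
    rintro _ ⟨a, s, ha, rfl⟩
    rw [div_le_iff₀' hc]
    have h1 := hle (c • x) _ _ (P_smul c hc a s ha)
    rw [← smul_add, hom c hc] at h1
    linarith
  have hhom : ∀ c : ℝ, 0 < c → ∀ x, sInf (S (c • x)) = c * sInf (S x) := by
    refine fun c hc x => le_antisymm (hhom_le c hc x) ?_
    have h1 := hhom_le c⁻¹ (inv_pos.2 hc) (c • x)
    rw [inv_smul_smul₀ hc.ne'] at h1
    rwa [← le_inv_mul_iff₀ hc]
  have hS0 : 0 ≤ sInf (S 0) := by
    refine le_csInf (hne 0) ?_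
    rintro _ ⟨a, s, ha, rfl⟩
    rw [zero_add]
    exact sub_nonneg.2 (hPq a s ha)
  -- Hahn–Banach, extending the zero functional from the trivial subspace.
  obtain ⟨φ, -, hφ⟩ := exists_extension_of_le_sublinear (⟨⊥, 0⟩ : V →ₗ.[ℝ] ℝ)
    (fun x => sInf (S x)) hhom hsub (by
      rintro ⟨x, hx⟩
      obtain rfl : x = 0 := (Submodule.mem_bot ℝ).1 hx
      exact hS0)
  refine ⟨φ, fun x => ?_, fun x s h => ?_⟩
  · simpa using (hφ x).trans (hle x 0 0 P_zero)
  -- Evaluating at `-x` with the cone element `(x, s)` gives `-φ x ≤ q 0 - s`.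
  · have h1 := (hφ (-x)).trans (hle (-x) x s h)
    rw [map_neg, neg_add_cancel, q_zero] at h1
    linarith

variable {Ω : Type*} {ge : (Ω → ℝ) → (Ω → ℝ) → Prop} {X : Set (Ω → ℝ)}

/-! ### Calculus of the common order -/

namespace IsCommonOrder

theorem add_right (hge : IsCommonOrder ge) {f g : Ω → ℝ} (h : ge f g) (k : Ω → ℝ) :
    ge (f + k) (g + k) := by
  simpa using hge.affine f g 1 k h ⟨1, fun _ => by simp⟩ zero_le_one

theorem add (hge : IsCommonOrder ge) {f g h k : Ω → ℝ} (hfg : ge f g) (hhk : ge h k) :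
    ge (f + h) (g + k) :=
  hge.trans _ _ _ (hge.add_right hfg h) (by simpa only [add_comm] using hge.add_right hhk g)

theorem smul (hge : IsCommonOrder ge) {f g : Ω → ℝ} (h : ge f g) {c : ℝ} (hc : 0 ≤ c) :
    ge (c • f) (c • g) := by
  have := hge.affine f g (fun _ => c) 0 h ⟨|c|, fun _ => le_rfl⟩ fun _ => hc
  rwa [add_zero, add_zero] at this

theorem sub_nonneg (hge : IsCommonOrder ge) {f g : Ω → ℝ} (h : ge f g) : ge (f - g) 0 := by
  simpa [← sub_eq_add_neg] using hge.add_right h (-g)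

/-- The negative part of a function `f ≥_* 0` is negligible. -/
theorem zero_ge_negPart (hge : IsCommonOrder ge) {f : Ω → ℝ} (h : ge f 0) : ge 0 f⁻ := by
  -- Multiplying `f` by the indicator of `{f < 0}` gives `-f⁻`; adding `f⁻` on both sides gives the
  -- claim.
  have h1 := hge.affine f 0 ({ω | f ω < 0}.indicator 1) f⁻ h (isBdd_indicator _)
    (Set.indicator_nonneg fun _ _ => zero_le_one)
  rw [mul_zero, zero_add] at h1
  convert h1 using 1
  ext ω
  by_cases hω : f ω < 0
  · simp [hω, negPart_def, hω.le]
  · simp [hω, negPart_def, not_lt.1 hω]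

/-- If `f ≥_* 0` then the set where `f` is below a negative constant is negligible. -/
theorem zero_ge_indicator (hge : IsCommonOrder ge) {f : Ω → ℝ} (h : ge f 0) {ε : ℝ}
    (hε : 0 < ε) : ge 0 ({ω | f ω < -ε}.indicator 1) := by
  have h1 := hge.affine f 0 ({ω | f ω < -ε}.indicator 1) 0 h (isBdd_indicator _)
    (Set.indicator_nonneg fun _ _ => zero_le_one)
  -- On the set in question `f` lies below `-ε`, so `-ε 1_A` dominates `1_A f` pointwise.
  have h2 : ge (-(ε • {ω | f ω < -ε}.indicator 1)) 0 := by
    refine hge.trans _ _ _ (hge.of_pointwise _ _ fun ω => ?_) (by simpa using h1)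
    by_cases hω : f ω < -ε
    · simpa [hω] using hω.le
    · simp [hω]
  have h3 := hge.smul (hge.add_right h2 (ε • {ω | f ω < -ε}.indicator 1)) (inv_nonneg.2 hε.le)
  simpa [smul_smul, hε.ne'] using h3

theorem strictPart_posPart (hge : IsCommonOrder ge) {f : Ω → ℝ} (h : StrictPart ge f 0) :
    StrictPart ge f⁺ 0 :=
  have hf : ge f⁺ f := hge.of_pointwise _ _ (le_posPart f)
  ⟨hge.trans _ _ _ hf h.1, fun h0 => h.2 (hge.trans _ _ _ h0 hf)⟩

end IsCommonOrder

/-! ### The complete market is a solid vector space -/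

/-- The complete market as a linear space. -/
def marketSpace (hge : IsCommonOrder ge) (hX : IsAssetSet ge X) : Submodule ℝ (Ω → ℝ) where
  carrier := completeMarket ge X
  zero_mem' := ⟨1, one_pos, 0, hX.zero_mem, by simpa using hge.refl 0⟩
  add_mem' := by
    rintro f g ⟨c, hc, x, hx, hf⟩ ⟨d, hd, y, hy, hg⟩
    have hcd : 0 < c + d := add_pos hc hd
    refine ⟨c + d, hcd, (c / (c + d)) • x + (d / (c + d)) • y,
      hX.convex hx hy (by positivity) (by positivity) (by field_simp), ?_⟩
    rw [smul_add, smul_smul, smul_smul, mul_div_cancel₀ _ hcd.ne', mul_div_cancel₀ _ hcd.ne']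
    exact hge.trans _ _ _ (hge.add hf hg) (hge.of_pointwise _ _ (abs_add_le f g))
  smul_mem' := by
    rintro c f ⟨d, hd, x, hx, hf⟩
    rcases eq_or_ne c 0 with rfl | hc
    · exact ⟨1, one_pos, 0, hX.zero_mem, by simpa using hge.refl 0⟩
    · refine ⟨|c| * d, by positivity, x, hx, ?_⟩
      have h := hge.smul hf (abs_nonneg c)
      rw [smul_smul] at h
      convert h using 1
      ext ω
      simp [abs_mul]

theorem marketSpace_solid (hge : IsCommonOrder ge) (hX : IsAssetSet ge X) (f g : Ω → ℝ)
    (hg : g ∈ marketSpace hge hX) (h : |f| ≤ |g|) : f ∈ marketSpace hge hX := by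
  obtain ⟨c, hc, x, hx, hcx⟩ := hg
  exact ⟨c, hc, x, hx, hge.trans _ _ _ hcx (hge.of_pointwise _ _ h)⟩

theorem one_mem_marketSpace (hge : IsCommonOrder ge) (hX : IsAssetSet ge X) :
    (1 : Ω → ℝ) ∈ marketSpace hge hX :=
  ⟨1, one_pos, 1, hX.one_mem, by
    rw [one_smul, abs_of_nonneg zero_le_one]
    exact hge.refl 1⟩

theorem mem_marketSpace_of_isBdd (hge : IsCommonOrder ge) (hX : IsAssetSet ge X) {f : Ω → ℝ}
    (hf : IsBdd f) : f ∈ marketSpace hge hX :=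
  mem_of_isBdd (marketSpace_solid hge hX) (one_mem_marketSpace hge hX) hf

theorem negPart_mem_marketSpace (hge : IsCommonOrder ge) (hX : IsAssetSet ge X) {f : Ω → ℝ}
    (h : ge f 0) : f⁻ ∈ marketSpace hge hX :=
  ⟨1, one_pos, 0, hX.zero_mem, by
    simpa [abs_of_nonneg (negPart_nonneg f)] using hge.zero_ge_negPart h⟩

/-- Truncation by `1` bounds a function only from above; taking the positive part supplies the lower
bound. -/
theorem isBdd_posPart_inf_one (f : Ω → ℝ) : IsBdd (f ⊓ 1)⁺ :=
  ⟨1, fun ω => by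
    rw [Pi.posPart_apply, abs_of_nonneg (posPart_nonneg _), posPart_def]
    exact max_le (min_le_right _ _) zero_le_one⟩

theorem inf_one_mem_marketSpace (hge : IsCommonOrder ge) (hX : IsAssetSet ge X) {f : Ω → ℝ}
    (h : StrictPart ge f 0) : f ⊓ 1 ∈ marketSpace hge hX := by
  rw [← posPart_sub_negPart (f ⊓ 1)]
  exact Submodule.sub_mem _ (mem_marketSpace_of_isBdd hge hX (isBdd_posPart_inf_one f))
    (negPart_mem_marketSpace hge hX (hge.trunc f h).1)

/-- An asset is bounded below only in the sense of `≥_*`. Adding cash gives an asset `y ≥_* 0`; as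
`y⁻` is negligible, `y ≥_* y⁺`, so `y` itself witnesses that `y⁺` belongs to `L(X)`. The functions
left over are negligible or constant. -/
theorem mem_marketSpace_of_mem (hge : IsCommonOrder ge) (hX : IsAssetSet ge X) {x : Ω → ℝ}
    (hx : x ∈ X) : x ∈ marketSpace hge hX := by
  obtain ⟨a, ha⟩ := hX.bounded_loss x hx
  have hy : (x + fun _ => |a|) ∈ X := hX.add_cash_mem x hx _ (abs_nonneg a)
  have hy0 : ge (x + fun _ => |a|) 0 :=
    hge.trans _ _ _ (hge.add_right ha _) (hge.of_pointwise _ _ fun ω => by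
      simpa using neg_le_iff_add_nonneg.1 (neg_abs_le a))
  set y := x + fun _ => |a| with hy_def
  have hyp : y⁺ ∈ marketSpace hge hX := by
    refine ⟨1, one_pos, y, hy, ?_⟩
    have := hge.add_right (hge.zero_ge_negPart hy0) y
    rw [zero_add, add_comm] at this
    rw [one_smul, abs_of_nonneg (posPart_nonneg y)]
    convert this using 1
    exact (eq_add_of_sub_eq (posPart_sub_negPart y)).trans rfl
  have hx' : x = y⁺ - y⁻ - fun _ => |a| := by rw [posPart_sub_negPart, hy_def, add_sub_cancel_right]
  rw [hx']
  exact Submodule.sub_mem _ (Submodule.sub_mem _ hyp (negPart_mem_marketSpace hge hX hy0))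
    (mem_marketSpace_of_isBdd hge hX ⟨|a|, fun _ => by simp⟩)

variable {π ρ : (Ω → ℝ) → ℝ}

/-! ### From a strictly positive measure to a completion -/

/-- A strictly positive finitely additive probability vanishes on negligible sets. -/
theorem content_eq_zero_of_zero_ge_indicator (hge : IsCommonOrder ge)
    {m : AddContent ℝ≥0 (Set.univ : Set (Set Ω))} (hm : IsFinAddProb m)
    (hpos : ∀ f, StrictPart ge f 0 → 0 < integral m (f ⊓ 1)) {A : Set Ω}
    (hA : ge 0 (A.indicator 1)) : m A = 0 := by
  by_contra hne
  have hmA : (m A : ℝ) ≠ 0 := by exact_mod_cast hne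
  have hK : 0 ≤ (m A : ℝ)⁻¹ := inv_nonneg.2 (NNReal.coe_nonneg _)
  set f : Ω → ℝ := (fun _ => 1) - A.indicator fun _ => (m A : ℝ)⁻¹ with hf
  have hf1 : ge f 1 := by
    have h := hge.add_right (hge.smul hA hK) f
    rw [smul_zero, zero_add] at h
    convert h using 1
    ext ω
    by_cases hω : ω ∈ A <;> simp [hf, hω]
  have hf0 : StrictPart ge f 0 :=
    ⟨hge.trans _ _ _ hf1 hge.one_gt_zero.1, fun h => hge.one_gt_zero.2 (hge.trans _ _ _ h hf1)⟩
  have hle : f ≤ 1 := fun ω => by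
    simpa [hf] using Set.indicator_nonneg (s := A) (fun _ _ => hK) ω
  have hI := ((HasIntegral.const hm 1).sub
    (HasIntegral.indicator (m := m) A (m A : ℝ)⁻¹)).integral_eq
  have := hpos f hf0
  rw [inf_eq_left.2 hle, hf, hI, inv_mul_cancel₀ hmA, sub_self] at this
  exact lt_irrefl _ this

theorem hasIntegral_nonneg_of_ge (hge : IsCommonOrder ge)
    {m : AddContent ℝ≥0 (Set.univ : Set (Set Ω))} (hm : IsFinAddProb m)
    (hpos : ∀ f, StrictPart ge f 0 → 0 < integral m (f ⊓ 1)) {f : Ω → ℝ} {I : ℝ}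
    (hf : ge f 0) (hI : HasIntegral m f I) : 0 ≤ I :=
  hI.nonneg fun _ hε =>
    content_eq_zero_of_zero_ge_indicator hge hm hpos (hge.zero_ge_indicator hf hε)

theorem marketPower_eq_zero_of_additive
    (hρ : ∀ {N : ℕ} (f : Fin N → Ω → ℝ), (∀ i, 0 ≤ f i ∧ IsBdd (f i)) →
      ρ (∑ i, f i) = ∑ i, ρ (f i)) : marketPower ρ ≤ 0 := by
  refine iSup_le fun N => iSup_le fun f => iSup_le fun hf => ?_
  simp [bundleMarketPower, hρ f hf]

theorem exists_completion_of_strictPricingMeasure (hge : IsCommonOrder ge) (hX : IsAssetSet ge X)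
    {m : AddContent ℝ≥0 (Set.univ : Set (Set Ω))} (hm : m ∈ strictPricingMeasures ge X π) :
    IsCompletion ge X π (integral m) ∧ IsCashAdditive (completeMarket ge X) (integral m) ∧
      marketPower (integral m) < 1 := by
  obtain ⟨⟨hprob, hint, hle⟩, hpos⟩ := hm
  have hI : ∀ g ∈ completeMarket ge X, HasIntegral m g (integral m g) := fun g hg => by
    obtain ⟨I, hI⟩ := hint g hg
    rwa [hI.integral_eq]
  have hmono : ∀ x ∈ completeMarket ge X, ∀ y ∈ completeMarket ge X, ge x y →
      integral m y ≤ integral m x := fun x hx y hy hxy =>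
    sub_nonneg.1 (hasIntegral_nonneg_of_ge hge hprob hpos (hge.sub_nonneg hxy)
      ((hI x hx).sub (hI y hy)))
  refine ⟨⟨⟨fun x hx c _ _ => ((hI x hx).smul c).integral_eq,
    fun x hx y hy _ => ((hI x hx).add (hI y hy)).integral_eq.le,
    (HasIntegral.const hprob 1).integral_eq, hmono, fun x hx h => ?_⟩, hle⟩,
    fun x hx a _ => ((hI x hx).add (HasIntegral.const hprob a)).integral_eq, ?_⟩
  -- Monotonicity carries the strict positivity of `∫ (x ∧ 1)` over to `∫ x`.
  · exact (hpos x h).trans_le (hmono x hx _ (inf_one_mem_marketSpace hge hX h)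
      (hge.of_pointwise _ _ inf_le_left))
  · refine (marketPower_eq_zero_of_additive fun {N} f hf => ?_).trans_lt zero_lt_one
    have key : ∀ s : Finset (Fin N), HasIntegral m (∑ i ∈ s, f i) (∑ i ∈ s, integral m (f i)) := by
      intro s
      induction s using Finset.cons_induction with
      | empty => exact HasIntegral.const hprob 0
      | cons a s ha ih =>
        rw [Finset.sum_cons, Finset.sum_cons]
        exact (hI _ (mem_marketSpace_of_isBdd hge hX (hf a).2)).add ih
    exact (key Finset.univ).integral_eq

/-! ### From a completion to a strictly positive measure -/

/-- `F` is the sum of finitely many nonnegative bounded functions with total price `s`. -/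
def IsBundle (ρ : (Ω → ℝ) → ℝ) (F : Ω → ℝ) (s : ℝ) : Prop :=
  ∃ (N : ℕ) (f : Fin N → Ω → ℝ), (∀ i, 0 ≤ f i ∧ IsBdd (f i)) ∧ ∑ i, f i = F ∧
    ∑ i, ρ (f i) = s

theorem IsBdd.add {f g : Ω → ℝ} (hf : IsBdd f) (hg : IsBdd g) : IsBdd (f + g) := by
  obtain ⟨C, hC⟩ := hf
  obtain ⟨D, hD⟩ := hg
  exact ⟨C + D, fun ω => (abs_add_le _ _).trans (add_le_add (hC ω) (hD ω))⟩

theorem IsBdd.smul {f : Ω → ℝ} (hf : IsBdd f) (c : ℝ) : IsBdd (c • f) := by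
  obtain ⟨C, hC⟩ := hf
  refine ⟨|c| * C, fun ω => ?_⟩
  rw [Pi.smul_apply, smul_eq_mul, abs_mul]
  exact mul_le_mul_of_nonneg_left (hC ω) (abs_nonneg c)

theorem IsBundle.nonneg_isBdd {F : Ω → ℝ} {s : ℝ} (h : IsBundle ρ F s) : 0 ≤ F ∧ IsBdd F := by
  obtain ⟨N, f, hf, rfl, -⟩ := h
  exact ⟨Finset.sum_nonneg fun i _ => (hf i).1,
    Finset.sum_induction f IsBdd (fun _ _ => IsBdd.add) ⟨0, fun _ => by simp⟩ fun i _ => (hf i).2⟩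

theorem isBundle_zero : IsBundle ρ 0 0 :=
  ⟨0, fun _ => 0, fun i => i.elim0, by simp, by simp⟩

theorem isBundle_single {f : Ω → ℝ} (h0 : 0 ≤ f) (hf : IsBdd f) : IsBundle ρ f (ρ f) :=
  ⟨1, fun _ => f, fun _ => ⟨h0, hf⟩, by simp, by simp⟩

theorem IsBundle.add {F G : Ω → ℝ} {s t : ℝ} (hF : IsBundle ρ F s) (hG : IsBundle ρ G t) :
    IsBundle ρ (F + G) (s + t) := by
  obtain ⟨N, f, hf, rfl, rfl⟩ := hF
  obtain ⟨M, g, hg, rfl, rfl⟩ := hG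
  refine ⟨N + M, Fin.append f g, fun i => ?_, ?_, ?_⟩
  · refine Fin.addCases (fun i => ?_) (fun i => ?_) i
    · simpa only [Fin.append_left] using hf i
    · simpa only [Fin.append_right] using hg i
  · simp [Fin.sum_univ_add]
  · simp [Fin.sum_univ_add]

theorem IsBundle.smul {F : Ω → ℝ} {s c : ℝ} (hc : 0 ≤ c)
    (hρ : ∀ f, 0 ≤ f → IsBdd f → ρ (c • f) = c * ρ f) (hF : IsBundle ρ F s) :
    IsBundle ρ (c • F) (c * s) := by
  obtain ⟨N, f, hf, rfl, rfl⟩ := hF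
  refine ⟨N, fun i => c • f i, fun i => ⟨smul_nonneg hc (hf i).1, (hf i).2.smul c⟩, ?_, ?_⟩
  · rw [Finset.smul_sum]
  · rw [Finset.mul_sum]
    exact Finset.sum_congr rfl fun i _ => hρ _ (hf i).1 (hf i).2

/-- If the market power is less than one, then the price of a bundle is at least a fixed fraction
of the total price of its parts. -/
theorem exists_mul_le_of_marketPower_lt_one (h : marketPower ρ < 1)
    (hρ : ∀ f, 0 ≤ f → IsBdd f → 0 ≤ ρ f) :
    ∃ c : ℝ, 0 < c ∧ ∀ F s, IsBundle ρ F s → c * s ≤ ρ F := by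
  obtain ⟨r, hr, hr1⟩ := EReal.lt_iff_exists_real_btwn.1 h
  have hr1' : r < 1 := by exact_mod_cast hr1
  refine ⟨1 - r, sub_pos.2 hr1', fun F s hF => ?_⟩
  have hF0 := hF.nonneg_isBdd
  obtain ⟨N, f, hf, rfl, rfl⟩ := hF
  have h1 : (bundleMarketPower ρ f : EReal) ≤ marketPower ρ :=
    le_iSup_of_le N (le_iSup_of_le f (le_iSup_of_le hf le_rfl))
  have h2 : bundleMarketPower ρ f ≤ r := by exact_mod_cast h1.trans hr.le
  -- When the total price is zero the quotient carries no information, and the bound follows from `ρ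
  -- F ≥ 0`.
  rcases (Finset.sum_nonneg fun i _ => hρ _ (hf i).1 (hf i).2 :
    0 ≤ ∑ i, ρ (f i)).eq_or_lt with h0 | h0
  · rw [← h0, mul_zero]
    exact hρ _ hF0.1 hF0.2
  · rw [bundleMarketPower, div_le_iff₀ h0] at h2
    linarith

/-- A completion with market power less than one dominates a linear functional which in turn
dominates a positive multiple of the completion on the nonnegative bounded functions. -/
theorem exists_linear_le_completion (hge : IsCommonOrder ge) (hX : IsAssetSet ge X)
    (hρ : IsPriceFunction ge (completeMarket ge X) ρ) (hma : marketPower ρ < 1) :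
    ∃ ψ : (Ω → ℝ) →ₗ[ℝ] ℝ, (∀ x ∈ marketSpace hge hX, ψ x ≤ ρ x) ∧
      ∃ c : ℝ, 0 < c ∧ ∀ f, 0 ≤ f → IsBdd f → c * ρ f ≤ ψ f := by
  have hB : ∀ {f : Ω → ℝ}, IsBdd f → f ∈ marketSpace hge hX := fun hf =>
    mem_marketSpace_of_isBdd hge hX hf
  have hρ0 : ρ 0 = 0 := by
    have h0 := (marketSpace hge hX).zero_mem
    simpa using hρ.pos_homogeneous 0 h0 0 le_rfl (by rw [smul_zero]; exact h0)
  obtain ⟨c, hc, hcb⟩ := exists_mul_le_of_marketPower_lt_one hma fun f hf0 hf => by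
    have := hρ.mono f (hB hf) 0 (marketSpace hge hX).zero_mem (hge.of_pointwise _ _ hf0)
    rwa [hρ0] at this
  obtain ⟨φ, hφ, hφc⟩ := exists_linear_sandwich (V := marketSpace hge hX) (fun x => ρ x)
    (fun a ha x => hρ.pos_homogeneous x x.2 a ha.le ((marketSpace hge hX).smul_mem a x.2))
    (fun x y => hρ.subadditive x x.2 y y.2 ((marketSpace hge hX).add_mem x.2 y.2))
    (fun x s => ∃ t, s = c * t ∧ IsBundle ρ (x : Ω → ℝ) t)
    ⟨0, (mul_zero c).symm, isBundle_zero⟩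
    (by
      rintro x _ y _ ⟨s, rfl, hs⟩ ⟨t, rfl, ht⟩
      exact ⟨s + t, (mul_add _ _ _).symm, hs.add ht⟩)
    (by
      rintro a ha x _ ⟨s, rfl, hs⟩
      exact ⟨a * s, mul_left_comm _ _ _, hs.smul ha.le fun f _ hf =>
        hρ.pos_homogeneous f (hB hf) a ha.le (hB (hf.smul a))⟩)
    (by
      rintro x _ ⟨s, rfl, hs⟩
      exact hcb _ _ hs)
  -- The extension beyond `L(X)` is arbitrary; it only makes `ψ` a functional on all functions, and
  -- its values there play no role.
  obtain ⟨ψ, hψ⟩ := φ.exists_extend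
  have hψφ : ∀ x (hx : x ∈ marketSpace hge hX), ψ x = φ ⟨x, hx⟩ := fun x hx =>
    DFunLike.congr_fun hψ ⟨x, hx⟩
  refine ⟨ψ, fun x hx => (hψφ x hx).trans_le (hφ ⟨x, hx⟩), c, hc, fun f hf0 hf => ?_⟩
  rw [hψφ f (hB hf)]
  exact hφc ⟨f, hB hf⟩ _ ⟨ρ f, rfl, isBundle_single hf0 hf⟩

theorem nonempty_strictPricingMeasures (hge : IsCommonOrder ge) (hX : IsAssetSet ge X)
    (hρ : IsCompletion ge X π ρ) (hcash : IsCashAdditive (completeMarket ge X) ρ)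
    (hma : marketPower ρ < 1) : (strictPricingMeasures ge X π).Nonempty := by
  obtain ⟨hρ, hρπ⟩ := hρ
  obtain ⟨ψ, hψρ, c, hc, hcψ⟩ := exists_linear_le_completion hge hX hρ hma
  set E := marketSpace hge hX with hE
  have hsolid : ∀ f g : Ω → ℝ, g ∈ E → |f| ≤ |g| → f ∈ E := marketSpace_solid hge hX
  have h1E : (1 : Ω → ℝ) ∈ E := one_mem_marketSpace hge hX
  have hρ0 : ρ 0 = 0 := by
    simpa using hρ.pos_homogeneous 0 E.zero_mem 0 le_rfl (by rw [smul_zero]; exact E.zero_mem)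
  have hψge : ∀ f ∈ E, ge f 0 → 0 ≤ ψ f := fun f hf h => by
    have h1 := hψρ (-f) (E.neg_mem hf)
    have h2 := hρ.mono 0 E.zero_mem (-f) (E.neg_mem hf) (by
      simpa using hge.add_right h (-f))
    rw [map_neg] at h1
    linarith
  have hψ0 : ∀ f ∈ E, 0 ≤ f → 0 ≤ ψ f := fun f hf h => hψge f hf (hge.of_pointwise _ _ h)
  have hψ1 : ψ 1 = 1 := by
    refine le_antisymm ((hψρ 1 h1E).trans hρ.map_one.le) ?_
    have h1 := hψρ (-1) (E.neg_mem h1E)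
    -- The shift by `-2` turns `1` into `-1`, so `ρ (-1) = -1` and hence `ψ 1 ≥ 1`.
    have h2 := hcash 1 h1E (-2) (mem_marketSpace_of_isBdd hge hX ⟨1, fun ω => by norm_num⟩)
    rw [show ((1 : Ω → ℝ) + fun _ => -2) = -1 by ext; norm_num, hρ.map_one] at h2
    rw [map_neg] at h1
    linarith
  have hind : ∀ A : Set Ω, 0 ≤ ψ (A.indicator 1) := fun A =>
    hψ0 _ (mem_of_isBdd hsolid h1E (isBdd_indicator A))
      (Set.indicator_nonneg fun _ _ => zero_le_one)
  set m := contentOfFunctional ψ hind with hm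
  have hprob : IsFinAddProb m := by
    refine NNReal.coe_injective ?_
    rw [hm, coe_contentOfFunctional, Set.indicator_univ, hψ1, NNReal.coe_one]
  have hrep : ∀ g ∈ E, 0 ≤ g → ∃ L, HasIntegral m g L ∧ L ≤ ψ g ∧ (IsBdd g → L = ψ g) :=
    fun g hg hg0 => exists_hasIntegral_contentOfFunctional hsolid h1E hψ0 hind hg hg0
  have hposE : ∀ g ∈ E, g⁺ ∈ E := fun g hg => hsolid _ g hg (by
    rw [abs_of_nonneg (posPart_nonneg g)]
    exact sup_le (le_abs_self g) (abs_nonneg g))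
  have hnegE : ∀ g ∈ E, g⁻ ∈ E := fun g hg => hsolid _ g hg (by
    rw [abs_of_nonneg (negPart_nonneg g)]
    exact sup_le (neg_le_abs g) (abs_nonneg g))
  -- Both `g⁻` and `-g⁻` are `≥_* 0`, which forces `ψ g⁻ = 0`; the integral of `g⁻` lies between `0`
  -- and this value.
  have hnull : ∀ g ∈ E, ge g 0 → HasIntegral m g⁻ 0 ∧ ψ g⁺ = ψ g := fun g hg h => by
    obtain ⟨L, hL, hLle, -⟩ := hrep g⁻ (hnegE g hg) (negPart_nonneg g)
    have h1 := hψge (-g⁻) (E.neg_mem (hnegE g hg)) (by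
      simpa using hge.add_right (hge.zero_ge_negPart h) (-g⁻))
    have h2 : 0 ≤ ψ g⁻ := hψ0 _ (hnegE g hg) (negPart_nonneg g)
    have h3 : 0 ≤ L := hL.nonneg fun ε hε => by
      have : {ω | g⁻ ω < -ε} = ∅ := by
        ext ω
        have := negPart_nonneg g ω
        simp only [Pi.zero_apply] at this
        simp only [Set.mem_ofPred_eq, Set.mem_empty_iff_false, iff_false, not_lt]
        linarith
      rw [this, addContent_empty]
    rw [map_neg] at h1
    have h4 : ψ g = ψ g⁺ - ψ g⁻ := by rw [← map_sub, posPart_sub_negPart]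
    obtain rfl : L = 0 := by linarith
    exact ⟨hL, by linarith⟩
  refine ⟨m, ⟨hprob, fun g hg => ?_, fun x hx => ?_⟩, fun f hf => ?_⟩
  · obtain ⟨L, hL, -⟩ := hrep g⁺ (hposE g hg) (posPart_nonneg g)
    obtain ⟨L', hL', -⟩ := hrep g⁻ (hnegE g hg) (negPart_nonneg g)
    exact ⟨L - L', by simpa only [posPart_sub_negPart] using hL.sub hL'⟩
  · have hxE : x ∈ E := mem_marketSpace_of_mem hge hX hx
    obtain ⟨a, ha⟩ := hX.bounded_loss x hx
    -- After the shift, `y ≥_* 0` has a null negative part, so `∫ y = ∫ y⁺ ≤ ψ y⁺ = ψ y`. The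
    -- one-sided bound suffices because the negative part contributes nothing.
    set y := x - fun _ => a with hy
    have haE : (fun _ : Ω => a) = a • (1 : Ω → ℝ) := by ext; simp
    have hyE : y ∈ E := by
      rw [hy, haE]
      exact E.sub_mem hxE (E.smul_mem a h1E)
    obtain ⟨hn, hyp⟩ := hnull y hyE (hge.sub_nonneg ha)
    obtain ⟨L, hL, hLle, -⟩ := hrep y⁺ (hposE y hyE) (posPart_nonneg y)
    have hI := (hL.sub hn).add (HasIntegral.const hprob a)
    rw [posPart_sub_negPart, hy, sub_add_cancel] at hI
    have hψy : ψ y = ψ x - a := by rw [hy, map_sub, haE, map_smul, hψ1, smul_eq_mul, mul_one]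
    rw [hI.integral_eq]
    linarith [hψρ x hxE, hρπ x hx]
  · have hf1 := hge.trunc f hf
    have hfE : f ⊓ 1 ∈ E := inf_one_mem_marketSpace hge hX hf
    have hbdd := isBdd_posPart_inf_one f
    obtain ⟨L, hL, -, hLeq⟩ := hrep _ (hposE _ hfE) (posPart_nonneg _)
    have hI := hL.sub (hnull _ hfE hf1.1).1
    rw [posPart_sub_negPart, sub_zero] at hI
    rw [hI.integral_eq, hLeq hbdd]
    -- Absence of arbitrage for `ρ` becomes strict positivity of `m` through the lower bound `c ρ ≤
    -- ψ`.
    exact (mul_pos hc (hρ.no_arbitrage _ (hposE _ hfE) (hge.strictPart_posPart hf1))).trans_le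
      (hcψ _ (posPart_nonneg _) hbdd)

end CommonOrderMarket

theorem mainTheorem2 {Ω : Type*} [Nonempty Ω]
    (ge : (Ω → ℝ) → (Ω → ℝ) → Prop) (X : Set (Ω → ℝ)) (π : (Ω → ℝ) → ℝ)
    (hge : CommonOrderMarket.IsCommonOrder ge)
    (hX : CommonOrderMarket.IsAssetSet ge X)
    (hπ : CommonOrderMarket.IsPriceFunction ge X π) :
    (CommonOrderMarket.strictPricingMeasures ge X π).Nonempty ↔
      ∃ ρ : (Ω → ℝ) → ℝ,
        CommonOrderMarket.IsCompletion ge X π ρ ∧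
        CommonOrderMarket.IsCashAdditive (CommonOrderMarket.completeMarket ge X) ρ ∧
        CommonOrderMarket.marketPower ρ < 1 :=
  ⟨fun ⟨_, hm⟩ =>
      ⟨_, CommonOrderMarket.exists_completion_of_strictPricingMeasure hge hX hm⟩,
    fun ⟨_, hρ, hcash, hma⟩ =>
      CommonOrderMarket.nonempty_strictPricingMeasures hge hX hρ hcash hma⟩
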